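/- **Setting (Repeated Joint Ads).** A *mechanism* consists of an allocation rule $x:[0,1]^2\to\{0,1\}$ and payments $p_1,p_2:[0,1]^2\to[0,1]$ which are ex-post dominant strategy incentive compatible and ex-post individually rational for agents with quasi-linear utilities: for all $w,b_1,b_2\in[0,1]$, $$w\,x(w,b_2)-p_1(w,b_2)\ \ge\ \max\{0,\ w\,x(b_1,b_2)-p_1(b_1,b_2)\},\qquad w\,x(b_1,w)-p_2(b_1,w)\ \ge\ \max\{0,\ w\,x(b_1,b_2)-p_2(b_1,b_2)\};$$ by convention the allocation region $\{x=1\}$ is closed. Let $\mathcal M$ be the class of all mechanisms. The revenue of $M=(x,p_1,p_2)$ on valuations $v\in[0,1]^2$ is $\mathsf{rev}(M,v)=x(v)\,(p_1(v)+p_2(v))$. A (possibly randomized) *learning algorithm* $\mathcal A$ chooses in each round $t=1,\dots,T$ a mechanism $M^t\in\mathcal M$ as a function of its internal randomness and of the valuations $v^1,\dots,v^{t-1}$ of the previous rounds (in such a way that $\mathsf{rev}(M^t,v)$ is jointly measurable in the internal randomness, $v^1,\dots,v^{t-1}$ and $v$). Against an adversary $\mathcal S$ that draws $(v^1,\dots,v^T)$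 from some law, independently of the internal randomness of $\mathcal A$, the regret is $$R_T(\mathcal A,\mathcal S)=\sup_{M\in\mathcal M}\mathbb E\Big[\sum_{t=1}^T \mathsf{rev}(M,v^t)-\sum_{t=1}^T\mathsf{rev}(M^t,v^t)\Big].$$ A probability measure $P$ on $[0,1]^2$ is *$\sigma$-smooth* if $P(B)\le \nu(B)/\sigma$ for every measurable $B\subseteq[0,1]^2$, where $\nu$ is the uniform distribution. A $\sigma$-smooth adversary chooses $\sigma$-smooth distributions $P_1,\dots,P_T$ and draws $v^1,\dots,v^T$ independently with $v^t\sim P_t$; $R_T(\mathcal A)$ is the supremum of $R_T(\mathcal A,\mathcal S)$ over all $\sigma$-smooth adversaries $\mathcal S$. **Theorem.** Let $0<\sigma\le \frac1{12}$. For every learning algorithm $\mathcal A$ and every $T$, $$R_T(\mathcal A)\ \ge\ \tfrac{3}{64}\sqrt T .$$ Moreover, this bound is already enforced by an i.i.d. adversary: for every $\mathcal A$ and $T$ there is $\alpha\in(\frac4{15},\frac25)$ such that the mixture $\mathbb P^\alpha$ of the uniform distribution on $[\frac12,\frac34]^2$ (with weight $\alpha$) and the uniform distribution on $[\frac34,1]^2$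 (with weight $1-\alpha$) is $\sigma$-smooth, and $R_T(\mathcal A,\mathcal S)\ge\frac3{64}\sqrt T$ for the adversary $\mathcal S$ that draws $v^1,\dots,v^T$ i.i.d. from $\mathbb P^\alpha$. -/

import Mathlib

open MeasureTheory
open scoped ENNReal

noncomputable section

namespace JointAds

/-- A pair of valuations (or of bids) in the unit square `[0,1]²`. -/
abbrev Valuation : Type := unitInterval × unitInterval

/-- A DSIC and IR mechanism for two agents and one non-excludable good: an allocation rule with
values in `{0,1}` and two payment functions with values in `[0,1]`. By convention the allocation
region is closed. An agent of value `w` who is in the situation described by the bids `b` has the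
quasi-linear utility `w * alloc b - pay b`. -/
structure Mechanism where
  /-- the allocation rule `x` -/
  alloc : Valuation → ℝ
  /-- the payment `p₁` of the first agent -/
  pay₁ : Valuation → ℝ
  /-- the payment `p₂` of the second agent -/
  pay₂ : Valuation → ℝ
  alloc_zero_or_one : ∀ b, alloc b = 0 ∨ alloc b = 1
  pay₁_mem : ∀ b, pay₁ b ∈ Set.Icc (0 : ℝ) 1
  pay₂_mem : ∀ b, pay₂ b ∈ Set.Icc (0 : ℝ) 1
  /-- DSIC for the first agent, of true value `w` -/
  dsic₁ : ∀ w b₁ b₂ : unitInterval,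
    (w : ℝ) * alloc (b₁, b₂) - pay₁ (b₁, b₂) ≤ (w : ℝ) * alloc (w, b₂) - pay₁ (w, b₂)
  /-- DSIC for the second agent, of true value `w` -/
  dsic₂ : ∀ w b₁ b₂ : unitInterval,
    (w : ℝ) * alloc (b₁, b₂) - pay₂ (b₁, b₂) ≤ (w : ℝ) * alloc (b₁, w) - pay₂ (b₁, w)
  /-- ex-post IR for the first agent, of true value `w` -/
  ir₁ : ∀ w b₂ : unitInterval, 0 ≤ (w : ℝ) * alloc (w, b₂) - pay₁ (w, b₂)
  /-- ex-post IR for the second agent, of true value `w` -/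
  ir₂ : ∀ w b₁ : unitInterval, 0 ≤ (w : ℝ) * alloc (b₁, w) - pay₂ (b₁, w)
  isClosed_region : IsClosed {v : Valuation | alloc v = 1}

/-- The revenue of a mechanism when the (truthful) agents have valuations `v`. -/
def Mechanism.rev (M : Mechanism) (v : Valuation) : ℝ :=
  M.alloc v * (M.pay₁ v + M.pay₂ v)

/-- A (randomized) learning algorithm whose internal randomness is a point of `Ω`: in round `t`
(rounds are numbered from `0`) it chooses a mechanism from its internal randomness and from the
valuations of the previous `t` rounds. Measurability is what makes expected revenues meaningful. -/
structure LearningAlgorithm (Ω : Type*) [MeasurableSpace Ω] where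
  /-- the mechanism of round `t` -/
  mech : (t : ℕ) → Ω → (Fin t → Valuation) → Mechanism
  measurable_rev : ∀ t : ℕ, Measurable
    fun z : Ω × (Fin t → Valuation) × Valuation => (mech t z.1 z.2.1).rev z.2.2

/-- The mechanism that the algorithm uses in round `t` when its internal randomness is `ω` and the
sequence of valuations is `v`: it depends on `v` only through the rounds before `t`. -/
def LearningAlgorithm.play {Ω : Type*} [MeasurableSpace Ω] (A : LearningAlgorithm Ω)
    {T : ℕ} (ω : Ω) (v : Fin T → Valuation) (t : Fin T) : Mechanism :=
  A.mech t ω fun s => v (Fin.castLE t.isLt.le s)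

/-- The regret over `T` rounds of the algorithm `A`, with internal randomness distributed according
to `μ`, against an adversary that draws the sequence of valuations from the law `P`,
independently of the internal randomness. -/
def regretAgainst {Ω : Type*} [MeasurableSpace Ω] (μ : Measure Ω) (A : LearningAlgorithm Ω)
    (T : ℕ) (P : Measure (Fin T → Valuation)) : EReal :=
  ⨆ M : Mechanism,
    ((∫ z : Ω × (Fin T → Valuation),
      (∑ t, M.rev (z.2 t) - ∑ t, (A.play z.1 z.2 t).rev (z.2 t)) ∂(μ.prod P) : ℝ) : EReal)

/-- A measure on the unit square is `σ`-smooth if it assigns to every measurable set at most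
`1/σ` times the mass that the uniform distribution assigns to it. -/
def IsSmooth (σ : ℝ) (μ : Measure Valuation) : Prop :=
  ∀ s : Set Valuation, MeasurableSet s → μ s ≤ (volume : Measure Valuation) s / ENNReal.ofReal σ

/-- The regret over `T` rounds in the `σ`-smooth setting: the supremum of the regret over all
adversaries that choose a `σ`-smooth distribution for every round, from which the
valuations of that round are drawn, independently of the other rounds. -/
def smoothRegret {Ω : Type*} [MeasurableSpace Ω] (σ : ℝ) (μ : Measure Ω)
    (A : LearningAlgorithm Ω) (T : ℕ) : EReal :=
  ⨆ (S : Fin T → ProbabilityMeasure Valuation) (_ : ∀ t, IsSmooth σ (S t : Measure Valuation)),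
    regretAgainst μ A T (Measure.pi fun t => (S t : Measure Valuation))

/-- The square `[1/2, 3/4]²`. -/
def Q₁ : Set Valuation :=
  {v | (v.1 : ℝ) ∈ Set.Icc (1 / 2 : ℝ) (3 / 4) ∧ (v.2 : ℝ) ∈ Set.Icc (1 / 2 : ℝ) (3 / 4)}

/-- The square `[3/4, 1]²`. -/
def Q₂ : Set Valuation :=
  {v | (v.1 : ℝ) ∈ Set.Icc (3 / 4 : ℝ) 1 ∧ (v.2 : ℝ) ∈ Set.Icc (3 / 4 : ℝ) 1}

/-- The mixture of the uniform distributions on `Q₁` (with weight `α`) and on `Q₂` (with weight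
`1 - α`), given by its density; both squares have area `1/16`. -/
def squareMixture (α : ℝ) : Measure Valuation :=
  (volume : Measure Valuation).withDensity fun v =>
    ENNReal.ofReal (16 * (α * Q₁.indicator (fun _ => (1 : ℝ)) v
      + (1 - α) * Q₂.indicator (fun _ => (1 : ℝ)) v))

end JointAds

end

/-! The bound is a two-point argument around the weight `α = 1/3`. Write `lowRev` and `highRev` for
the expected revenues of a mechanism on the uniform distributions on `Q₁` and `Q₂`. The heart is
`Mechanism.lowRev_le_one_and_tradeoff`: winning sets are upward closed and a winner pays at most any
value at which they would still win, so selling on `Q₁` caps the prices on all of `Q₂`. This gives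
`lowRev + 2 * highRev ≤ 3`, so no mechanism earns more than `1` at `α = 1/3`, a value attained by
the posted prices `1/2` and `3/4`.

At weight `1/3 + e` the trade-off bounds the revenue by `1 - 3/2 * e * (1 - lowRev)`. For `e = ε`
price `1/2` earns `1`, so a round costs at least `3/2 * ε * (1 - lowRev)`; for `e = -ε` price `3/4`
earns at least `1 + 3/2 * ε`, so it costs at least `3/2 * ε * lowRev`. The two costs would sum to
`3/2 * ε` if the expected `lowRev` were the same in both worlds.

It nearly is: `lowRev` of the chosen mechanism is a `[0,1]`-valued function of the history and the
internal randomness, and by a second-moment bound on likelihood ratios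
(`integral_pi_withDensity_sub_le`) the expectations of such a function differ by at most `1/4` when
`ε = 1 / (12 * √T)`. Hence the two regrets add up to at least `T * (3/2 * ε * (3/4)) = 3/32 * √T`,
and one of them is at least half of that. -/

namespace JointAds

/-! ### Indistinguishability of product measures with nearby densities. -/

section ProductDensities

variable {ι α : Type*} [Fintype ι] [MeasurableSpace α]

/-- A product measure is determined by its values on boxes, and there the integral of the product
factors because coordinates are independent. -/
theorem pi_withDensity (ν : Measure α) [IsProbabilityMeasure ν] {f : α → ℝ≥0∞}
    (hf : Measurable f) [SigmaFinite (ν.withDensity f)] :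
    Measure.pi (fun _ : ι => ν.withDensity f)
      = (Measure.pi fun _ : ι => ν).withDensity fun x => ∏ i, f (x i) := by
  refine Measure.pi_eq fun s hs => ?_
  have hbox : MeasurableSet (Set.univ.pi s) := MeasurableSet.univ_pi hs
  rw [withDensity_apply _ hbox, ← lintegral_indicator hbox]
  have hind : (Set.univ.pi s).indicator (fun x : ι → α => ∏ i, f (x i))
      = fun x => ∏ i, (s i).indicator f (x i) := by
    funext x
    by_cases hx : x ∈ Set.univ.pi s
    · rw [Set.indicator_of_mem hx]
      exact Finset.prod_congr rfl fun i _ =>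
        (Set.indicator_of_mem (hx i (Set.mem_univ i)) f).symm
    · rw [Set.indicator_of_notMem hx]
      simp only [Set.mem_univ_pi, not_forall] at hx
      obtain ⟨i, hi⟩ := hx
      exact (Finset.prod_eq_zero (Finset.mem_univ i) (Set.indicator_of_notMem hi f)).symm
  have hm : ∀ i, Measurable ((s i).indicator f) := fun i => hf.indicator (hs i)
  have hindep := ProbabilityTheory.iIndepFun_pi (μ := fun _ : ι => ν)
    (X := fun i => (s i).indicator f) fun i => (hm i).aemeasurable
  rw [hind, ProbabilityTheory.lintegral_prod_eq_prod_lintegral_of_indepFun Finset.univ _ hindep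
    fun i => (hm i).comp (measurable_pi_apply i)]
  refine Finset.prod_congr rfl fun i _ => ?_
  rw [withDensity_apply _ (hs i), ← lintegral_indicator (hs i)]
  exact (measurePreserving_eval (fun _ : ι => ν) i).lintegral_comp (hm i)

theorem integral_pi_withDensity (ν : Measure α) [IsProbabilityMeasure ν] {f : α → ℝ}
    (hf : Measurable f) (hf0 : ∀ a, 0 ≤ f a)
    [SigmaFinite (ν.withDensity fun a => ENNReal.ofReal (f a))] (g : (ι → α) → ℝ) :
    ∫ x, g x ∂(Measure.pi fun _ : ι => ν.withDensity fun a => ENNReal.ofReal (f a))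
      = ∫ x, (∏ i, f (x i)) * g x ∂(Measure.pi fun _ : ι => ν) := by
  have hm : Measurable fun x : ι → α => ∏ i, ENNReal.ofReal (f (x i)) :=
    Finset.measurable_prod _ fun i _ => (hf.comp (measurable_pi_apply i)).ennreal_ofReal
  rw [pi_withDensity ν hf.ennreal_ofReal, integral_withDensity_eq_integral_toReal_smul hm]
  · refine integral_congr_ae (Filter.Eventually.of_forall fun x => ?_)
    simp [ENNReal.toReal_prod, ENNReal.toReal_ofReal, hf0]
  · exact Filter.Eventually.of_forall fun x =>
      ENNReal.prod_lt_top fun i _ => ENNReal.ofReal_lt_top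

/-- Two product measures whose factors have the densities `1 + ε ξ` and `1 - ε ξ` are hard to tell
apart as long as the number of factors is small compared with the inverse of `ε² 𝔼[ξ²]`. -/
theorem integral_pi_withDensity_sub_le (ν : Measure α) [IsProbabilityMeasure ν] {ξ : α → ℝ}
    (hξ : Measurable ξ) {ε κ : ℝ} (hpos : ∀ a, 0 ≤ 1 + ε * ξ a) (hneg : ∀ a, 0 ≤ 1 - ε * ξ a)
    (hε : ε ≠ 0) (hmean : ∫ a, ξ a ∂ν = 0) (hvar : ∫ a, ξ a ^ 2 ∂ν = κ)
    [SigmaFinite (ν.withDensity fun a => ENNReal.ofReal (1 + ε * ξ a))]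
    [SigmaFinite (ν.withDensity fun a => ENNReal.ofReal (1 - ε * ξ a))]
    (hsmall : Fintype.card ι * (ε ^ 2 * κ) ≤ 1 / 32)
    {g : (ι → α) → ℝ} (hg : Measurable g) (hg0 : ∀ x, 0 ≤ g x) (hg1 : ∀ x, g x ≤ 1) :
    ∫ x, g x ∂(Measure.pi fun _ : ι => ν.withDensity fun a => ENNReal.ofReal (1 + ε * ξ a))
      - ∫ x, g x ∂(Measure.pi fun _ : ι => ν.withDensity fun a => ENNReal.ofReal (1 - ε * ξ a))
      ≤ 1 / 4 := by
  set n := Fintype.card ι with hn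
  rw [integral_pi_withDensity ν (by fun_prop) hpos, integral_pi_withDensity ν (by fun_prop) hneg]
  set π := Measure.pi fun _ : ι => ν with hπ
  set L : (ι → α) → ℝ := fun x => ∏ i, (1 + ε * ξ (x i)) with hL
  set K : (ι → α) → ℝ := fun x => ∏ i, (1 - ε * ξ (x i)) with hK
  have hbound : ∀ a, |ξ a| ≤ |ε|⁻¹ := fun a => by
    have : |ε * ξ a| ≤ 1 := abs_le.2 ⟨by linarith [hpos a], by linarith [hneg a]⟩
    rw [abs_mul] at this
    rw [← one_div, le_div_iff₀ (abs_pos.2 hε)]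
    linarith
  have hint : Integrable ξ ν :=
    Integrable.of_bound hξ.aestronglyMeasurable |ε|⁻¹ (Filter.Eventually.of_forall hbound)
  have hint2 : Integrable (fun a => ξ a ^ 2) ν :=
    Integrable.of_bound (by fun_prop) (|ε|⁻¹ ^ 2) (Filter.Eventually.of_forall fun a => by
      rw [Real.norm_eq_abs, abs_pow]
      exact pow_le_pow_left₀ (abs_nonneg _) (hbound a) 2)
  -- The likelihood ratios `L`, `K`, their squares and `L * K` are all products of quadratics in
  -- `ξ`; as `ξ` is centred, only the quadratic coefficient affects their integrals.
  have hquad : ∀ c d : ℝ, Integrable (fun a => 1 + c * ξ a + d * ξ a ^ 2) ν ∧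
      ∫ a, (1 + c * ξ a + d * ξ a ^ 2) ∂ν = 1 + d * κ := fun c d => by
    have h1 : Integrable (fun a => 1 + c * ξ a) ν := (integrable_const _).add (hint.const_mul c)
    refine ⟨h1.add (hint2.const_mul d), ?_⟩
    rw [integral_add h1 (hint2.const_mul d), integral_add (integrable_const _) (hint.const_mul c),
      integral_const_mul, integral_const_mul, hmean, hvar]
    simp
  have hprod : ∀ c d : ℝ, Integrable (fun x : ι → α => ∏ i, (1 + c * ξ (x i) + d * ξ (x i) ^ 2)) π
      ∧ ∫ x, ∏ i, (1 + c * ξ (x i) + d * ξ (x i) ^ 2) ∂π = (1 + d * κ) ^ n := fun c d => by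
    refine ⟨Integrable.fintype_prod (f := fun _ : ι => fun a => 1 + c * ξ a + d * ξ a ^ 2)
      fun _ => (hquad c d).1, ?_⟩
    rw [hπ, integral_fintype_prod_eq_pow (fun a => 1 + c * ξ a + d * ξ a ^ 2), (hquad c d).2]
  have eL : L = fun x => ∏ i, (1 + ε * ξ (x i) + 0 * ξ (x i) ^ 2) := by simp [hL]
  have eK : K = fun x => ∏ i, (1 + (-ε) * ξ (x i) + 0 * ξ (x i) ^ 2) := by
    simp [hK, sub_eq_add_neg]
  have eLL : (fun x => L x ^ 2) = fun x => ∏ i, (1 + (2 * ε) * ξ (x i) + ε ^ 2 * ξ (x i) ^ 2) := by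
    funext x
    simp only [hL, ← Finset.prod_pow]
    exact Finset.prod_congr rfl fun i _ => by ring
  have eKK : (fun x => K x ^ 2)
      = fun x => ∏ i, (1 + (-2 * ε) * ξ (x i) + ε ^ 2 * ξ (x i) ^ 2) := by
    funext x
    simp only [hK, ← Finset.prod_pow]
    exact Finset.prod_congr rfl fun i _ => by ring
  have eLK : (fun x => L x * K x) = fun x => ∏ i, (1 + 0 * ξ (x i) + (-ε ^ 2) * ξ (x i) ^ 2) := by
    funext x
    simp only [hL, hK, ← Finset.prod_mul_distrib]
    exact Finset.prod_congr rfl fun i _ => by ring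
  have iL : Integrable L π := eL ▸ (hprod ε 0).1
  have iK : Integrable K π := eK ▸ (hprod (-ε) 0).1
  have iLL : Integrable (fun x => L x ^ 2) π := eLL ▸ (hprod _ _).1
  have iKK : Integrable (fun x => K x ^ 2) π := eKK ▸ (hprod _ _).1
  have iLK : Integrable (fun x => L x * K x) π := eLK ▸ (hprod _ _).1
  have vL : ∫ x, L x ∂π = 1 := by rw [eL, (hprod ε 0).2]; simp
  have vK : ∫ x, K x ∂π = 1 := by rw [eK, (hprod (-ε) 0).2]; simp
  have vLL : ∫ x, L x ^ 2 ∂π = (1 + ε ^ 2 * κ) ^ n := by rw [eLL, (hprod _ _).2]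
  have vKK : ∫ x, K x ^ 2 ∂π = (1 + ε ^ 2 * κ) ^ n := by rw [eKK, (hprod _ _).2]
  have vLK : ∫ x, L x * K x ∂π = (1 + -ε ^ 2 * κ) ^ n := by rw [eLK, (hprod _ _).2]
  have hgb : ∀ᵐ x ∂π, ‖g x‖ ≤ 1 := Filter.Eventually.of_forall fun x => by
    rw [Real.norm_eq_abs, abs_of_nonneg (hg0 x)]; exact hg1 x
  have iLg : Integrable (fun x => L x * g x) π := iL.mul_bdd hg.aestronglyMeasurable hgb
  have iKg : Integrable (fun x => K x * g x) π := iK.mul_bdd hg.aestronglyMeasurable hgb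
  have i1 : Integrable (fun x => 1 / 2 * L x - 1 / 2 * K x) π :=
    (iL.const_mul _).sub (iK.const_mul _)
  have i2 : Integrable (fun x => 1 / 2 * L x ^ 2 + 1 / 2 * K x ^ 2) π :=
    (iLL.const_mul _).add (iKK.const_mul _)
  have i3 : Integrable (fun x => 1 / 8 - L x * K x) π := (integrable_const _).sub iLK
  have i4 : Integrable (fun x => (1 / 2 * L x - 1 / 2 * K x)
    + (1 / 2 * L x ^ 2 + 1 / 2 * K x ^ 2)) π := i1.add i2
  -- With `d = L - K`, the integrand is at most the positive part `(d + |d|) / 2`, and `|d| ≤ d² +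
  -- 1/4`. Expanding `d²` leaves only moments computed above.
  have hle : ∫ x, (L x * g x - K x * g x) ∂π
      ≤ ∫ x, (((1 / 2 * L x - 1 / 2 * K x) + (1 / 2 * L x ^ 2 + 1 / 2 * K x ^ 2))
        + (1 / 8 - L x * K x)) ∂π := by
    refine integral_mono (iLg.sub iKg) (i4.add i3) fun x => ?_
    have h0 := hg0 x
    have h1 := hg1 x
    change L x * g x - K x * g x ≤ _
    rcases le_total 0 (L x - K x) with h | h
    · nlinarith [mul_nonneg h (sub_nonneg.2 h1), sq_nonneg (L x - K x - 1 / 2)]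
    · nlinarith [mul_nonneg (neg_nonneg.2 h) h0, sq_nonneg (L x - K x + 1 / 2)]
  rw [integral_sub iLg iKg, integral_add i4 i3, integral_add i1 i2,
    integral_sub (iL.const_mul _) (iK.const_mul _), integral_add (iLL.const_mul _) (iKK.const_mul _),
    integral_sub (integrable_const _) iLK] at hle
  simp only [integral_const_mul, vL, vK, vLL, vKK, vLK, integral_const, probReal_univ,
    smul_eq_mul, one_mul] at hle
  refine hle.trans ?_
  have hκ : 0 ≤ κ := hvar ▸ integral_nonneg fun a => sq_nonneg _
  have hy : 0 ≤ ε ^ 2 * κ := mul_nonneg (sq_nonneg _) hκ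
  rw [neg_mul]
  generalize ε ^ 2 * κ = y at *
  rcases Nat.eq_zero_or_pos n with h0 | hnpos
  · rw [h0]; norm_num
  have hn1 : (1 : ℝ) ≤ n := by exact_mod_cast hnpos
  have hy1 : y ≤ 1 / 32 := by nlinarith
  -- It remains to bound `(1 + y)^n - (1 - y)^n + 1/8`. Bernoulli gives `(1 - y)^n ≥ 31/32`, and `(1
  -- - y²)^n ≤ 1` then gives `(1 + y)^n ≤ 32/31`.
  have hB : 1 - n * y ≤ (1 + -y) ^ n := by
    have := one_add_mul_le_pow (a := -y) (by linarith) n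
    linarith
  have hprod1 : (1 + y) ^ n * (1 + -y) ^ n ≤ 1 := by
    rw [← mul_pow]
    exact pow_le_one₀ (by nlinarith) (by nlinarith)
  have hU : (1 + y) ^ n ≤ 32 / 31 := by
    have h3 : 0 ≤ (1 + y) ^ n := by positivity
    nlinarith
  nlinarith

end ProductDensities

/-! ### Marginals of i.i.d. sequences. -/

section Coordinates

variable {α : Type*} [MeasurableSpace α]

theorem measurePreserving_comp_injective {ι κ : Type*} [Fintype ι] [Fintype κ] (ν : Measure α)
    [IsProbabilityMeasure ν] {e : κ → ι} (he : Function.Injective e) :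
    MeasurePreserving (fun (v : ι → α) k => v (e k)) (Measure.pi fun _ => ν)
      (Measure.pi fun _ => ν) := by
  classical
  have hm : Measurable fun (v : ι → α) k => v (e k) := by fun_prop
  refine ⟨hm, (Measure.pi_eq fun s hs => ?_).symm⟩
  rw [Measure.map_apply hm (MeasurableSet.univ_pi hs)]
  have hpre : (fun (v : ι → α) k => v (e k)) ⁻¹' Set.univ.pi s
      = Set.univ.pi (Function.extend e s fun _ => Set.univ) := by
    ext v
    simp only [Set.mem_preimage, Set.mem_univ_pi]
    refine ⟨fun h i => ?_, fun h k => ?_⟩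
    · by_cases hi : ∃ k, e k = i
      · obtain ⟨k, rfl⟩ := hi
        rw [he.extend_apply]; exact h k
      · rw [Function.extend_apply' _ _ _ hi]; trivial
    · have := h (e k)
      rwa [he.extend_apply] at this
  rw [hpre, Measure.pi_pi]
  have : ∀ i, i ∉ Finset.univ.image e →
      ν (Function.extend e s (fun _ => Set.univ) i) = 1 := fun i hi => by
    rw [Function.extend_apply', measure_univ]
    rintro ⟨k, rfl⟩
    exact hi (Finset.mem_image_of_mem e (Finset.mem_univ k))
  rw [← Finset.prod_subset (Finset.subset_univ (Finset.univ.image e)) fun i _ hi => this i hi,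
    Finset.prod_image he.injOn]
  exact Finset.prod_congr rfl fun k _ => by rw [he.extend_apply]

/-- Restricting to the first `t + 1` coordinates and splitting off the last one shows that the
present valuation is independent of the past. -/
theorem measurePreserving_past_present (ν : Measure α) [IsProbabilityMeasure ν] {T : ℕ}
    (t : Fin T) :
    MeasurePreserving (fun v : Fin T → α => ((fun s : Fin t => v (Fin.castLE t.isLt.le s)), v t))
      (Measure.pi fun _ => ν) ((Measure.pi fun _ : Fin t => ν).prod ν) := by
  have h1 := measurePreserving_comp_injective ν
    (Fin.castLE_injective (Nat.succ_le_of_lt t.isLt))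
  have h2 := measurePreserving_piFinSuccAbove (fun _ : Fin (t + 1) => ν) (Fin.last t)
  have h := (Measure.measurePreserving_swap (μ := ν)
    (ν := Measure.pi fun _ : Fin t => ν)).comp (h2.comp h1)
  convert h using 1
  funext v
  refine Prod.ext (funext fun s => ?_) ?_
  · simp
    rfl
  · simp
    rfl

end Coordinates

/-! ### Areas of the two squares. -/

/-- The valuations between `c` and `d`. -/
def valueRange (c d : ℝ) : Set unitInterval := {w | (w : ℝ) ∈ Set.Icc c d}

theorem measurableSet_valueRange (c d : ℝ) : MeasurableSet (valueRange c d) :=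
  measurable_subtype_coe measurableSet_Icc

theorem volume_real_valueRange {c d : ℝ} (hc : 0 ≤ c) (hcd : c ≤ d) (hd : d ≤ 1) :
    (volume : Measure unitInterval).real (valueRange c d) = d - c := by
  have : valueRange c d = Set.Icc (⟨c, hc, hcd.trans hd⟩ : unitInterval) ⟨d, hc.trans hcd, hd⟩ := rfl
  rw [this, Measure.real, unitInterval.volume_Icc]
  exact ENNReal.toReal_ofReal (sub_nonneg.2 hcd)

theorem Q₁_eq : Q₁ = valueRange (1 / 2) (3 / 4) ×ˢ valueRange (1 / 2) (3 / 4) := rfl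

theorem Q₂_eq : Q₂ = valueRange (3 / 4) 1 ×ˢ valueRange (3 / 4) 1 := rfl

theorem measurableSet_Q₁ : MeasurableSet Q₁ :=
  (measurableSet_valueRange _ _).prod (measurableSet_valueRange _ _)

theorem measurableSet_Q₂ : MeasurableSet Q₂ :=
  (measurableSet_valueRange _ _).prod (measurableSet_valueRange _ _)

theorem volume_real_Q₁ : (volume : Measure Valuation).real Q₁ = 1 / 16 := by
  rw [Q₁_eq, Measure.volume_eq_prod, measureReal_prod_prod,
    volume_real_valueRange (by norm_num) (by norm_num) (by norm_num)]
  norm_num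

theorem volume_real_Q₂ : (volume : Measure Valuation).real Q₂ = 1 / 16 := by
  rw [Q₂_eq, Measure.volume_eq_prod, measureReal_prod_prod,
    volume_real_valueRange (by norm_num) (by norm_num) (by norm_num)]
  norm_num

/-! ### Structure of incentive-compatible mechanisms: monotonicity, threshold payments,
measurability. -/

namespace Mechanism

variable (M : Mechanism)

/-- The mechanism in which the two agents exchange their roles. -/
@[simps] def swap : Mechanism where
  alloc b := M.alloc b.swap
  pay₁ b := M.pay₂ b.swap
  pay₂ b := M.pay₁ b.swap
  alloc_zero_or_one b := M.alloc_zero_or_one b.swap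
  pay₁_mem b := M.pay₂_mem b.swap
  pay₂_mem b := M.pay₁_mem b.swap
  dsic₁ w b₁ b₂ := M.dsic₂ w b₂ b₁
  dsic₂ w b₁ b₂ := M.dsic₁ w b₂ b₁
  ir₁ w b := M.ir₂ w b
  ir₂ w b := M.ir₁ w b
  isClosed_region := M.isClosed_region.preimage continuous_swap

/-- The revenue from the second agent. -/
def rev₂ (v : Valuation) : ℝ := M.alloc v * M.pay₂ v

theorem rev_eq (v : Valuation) : M.rev v = M.swap.rev₂ v.swap + M.rev₂ v := by
  simp [rev, rev₂, mul_add]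

variable {M}

theorem pay₂_le_of_alloc {b w : unitInterval} (h : M.alloc (b, w) = 1) :
    M.pay₂ (b, w) ≤ w := by
  have := M.ir₂ w b
  rw [h] at this
  linarith

theorem pay₂_le_pay₂ {b w w' : unitInterval} (h : M.alloc (b, w) = 1)
    (h' : M.alloc (b, w') = 1) : M.pay₂ (b, w) ≤ M.pay₂ (b, w') := by
  have := M.dsic₂ w b w'
  rw [h, h'] at this
  linarith

theorem pay₂_eq_pay₂ {b w w' : unitInterval} (h : M.alloc (b, w) = 1)
    (h' : M.alloc (b, w') = 1) : M.pay₂ (b, w) = M.pay₂ (b, w') :=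
  (pay₂_le_pay₂ h h').antisymm (pay₂_le_pay₂ h' h)

/-- Otherwise a loser of value `w` would gain by bidding `w'`. -/
theorem le_pay₂_of_alloc_eq_zero {b w w' : unitInterval} (h : M.alloc (b, w) = 0)
    (h' : M.alloc (b, w') = 1) : (w : ℝ) ≤ M.pay₂ (b, w') := by
  have := M.dsic₂ w b w'
  rw [h, h'] at this
  linarith [(M.pay₂_mem (b, w)).1]

/-- If `w'` lost, the price of winning would be at least `w'` by incentive compatibility and at most
`w` by individual rationality, forcing `w' = w`. -/
theorem alloc_mono₂ {b w w' : unitInterval} (hw : w ≤ w') (h : M.alloc (b, w) = 1) :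
    M.alloc (b, w') = 1 := by
  rcases M.alloc_zero_or_one (b, w') with h' | h'
  · have h1 : (w' : ℝ) ≤ w := (le_pay₂_of_alloc_eq_zero h' h).trans (pay₂_le_of_alloc h)
    rwa [le_antisymm (a := w') (Subtype.coe_le_coe.1 h1) hw]
  · exact h'

theorem alloc_mono {v v' : Valuation} (hv : v ≤ v') (h : M.alloc v = 1) : M.alloc v' = 1 :=
  alloc_mono₂ (b := v'.1) hv.2 (alloc_mono₂ (M := M.swap) (b := v.2) hv.1 h)

/-- Nobody pays more than the value at which they would still win against weaker bids. -/
theorem pay₂_le_of_le {v v' : Valuation} (hv : v ≤ v') (h : M.alloc v = 1) :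
    M.pay₂ v' ≤ v.2 := by
  have h' : M.alloc (v'.1, v.2) = 1 := alloc_mono (v := v) ⟨hv.1, le_rfl⟩ h
  exact (pay₂_le_pay₂ (b := v'.1) (w := v'.2) (alloc_mono hv h) h').trans (pay₂_le_of_alloc h')

variable (M)

theorem rev₂_nonneg (v : Valuation) : 0 ≤ M.rev₂ v := by
  rcases M.alloc_zero_or_one v with h | h <;> simp [rev₂, h, (M.pay₂_mem v).1]

theorem rev₂_le_one (v : Valuation) : M.rev₂ v ≤ 1 := by
  rcases M.alloc_zero_or_one v with h | h <;> simp [rev₂, h, (M.pay₂_mem v).2]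

theorem rev_nonneg (v : Valuation) : 0 ≤ M.rev v := by
  rw [rev_eq]; exact add_nonneg (M.swap.rev₂_nonneg _) (M.rev₂_nonneg _)

theorem rev_le_two (v : Valuation) : M.rev v ≤ 2 := by
  rw [rev_eq]; linarith [M.swap.rev₂_le_one v.swap, M.rev₂_le_one v]

/-- Payments are not assumed measurable, but on the allocation region they are thresholds, so
closedness of that region is enough. -/
theorem measurable_rev₂ : Measurable M.rev₂ := by
  refine measurable_of_Ioi fun r => ?_
  rcases lt_or_ge r 0 with hr | hr
  · have : M.rev₂ ⁻¹' Set.Ioi r = Set.univ :=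
      Set.eq_univ_of_forall fun v => hr.trans_le (M.rev₂_nonneg v)
    rw [this]; exact MeasurableSet.univ
  have hA := M.isClosed_region.measurableSet
  have hB : ∀ q : unitInterval, MeasurableSet {v : Valuation | M.alloc (v.1, q) = 1} := fun q =>
    (M.isClosed_region.preimage (continuous_fst.prodMk continuous_const)).measurableSet
  have hproj : ∀ q : ℝ, 0 < q → q ≤ 1 → (Set.projIcc (0 : ℝ) 1 zero_le_one q : ℝ) = q :=
    fun q h0 h1 => by rw [Set.projIcc_of_mem zero_le_one ⟨h0.le, h1⟩]
  -- A winner pays more than `r` exactly when some rational bid `q > r` in place of theirs would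
  -- lose. `Set.projIcc` only casts `q` into the unit interval.
  have : M.rev₂ ⁻¹' Set.Ioi r = ⋃ q : {q : ℚ // r < q ∧ (q : ℝ) ≤ 1},
      {v : Valuation | M.alloc v = 1}
        \ {v : Valuation | M.alloc (v.1, Set.projIcc (0 : ℝ) 1 zero_le_one (q : ℚ)) = 1} := by
    ext v
    simp only [Set.mem_preimage, Set.mem_Ioi, Set.mem_iUnion, Set.mem_sdiff, Set.mem_ofPred_eq]
    constructor
    · intro hv
      rcases M.alloc_zero_or_one v with h | h
      · simp only [rev₂, h, zero_mul] at hv; linarith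
      simp only [rev₂, h, one_mul] at hv
      obtain ⟨q, hq, hqv⟩ := exists_rat_btwn hv
      have hq1 : (q : ℝ) ≤ 1 := hqv.le.trans (M.pay₂_mem v).2
      refine ⟨⟨q, hq, hq1⟩, h, fun h' => ?_⟩
      have h2 := pay₂_le_of_alloc h'
      rw [← pay₂_eq_pay₂ (b := v.1) (w := v.2) h h', hproj _ (hr.trans_lt hq) hq1] at h2
      exact absurd hqv h2.not_gt
    · rintro ⟨⟨q, hq, hq1⟩, h, h'⟩
      have h2 := le_pay₂_of_alloc_eq_zero (w' := v.2) ((M.alloc_zero_or_one _).resolve_right h') h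
      rw [hproj _ (hr.trans_lt hq) hq1] at h2
      simp only [rev₂, h, one_mul]
      exact hq.trans_le h2
  rw [this]
  exact MeasurableSet.iUnion fun q => hA.diff (hB _)

theorem measurable_rev : Measurable M.rev := by
  have : M.rev = fun v => M.swap.rev₂ v.swap + M.rev₂ v := funext M.rev_eq
  rw [this]
  exact (M.swap.measurable_rev₂.comp measurable_swap).add M.measurable_rev₂

theorem integrable_rev₂ (P : Measure Valuation) [IsFiniteMeasure P] : Integrable M.rev₂ P :=
  Integrable.of_bound M.measurable_rev₂.aestronglyMeasurable 1 (Filter.Eventually.of_forall fun v =>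
    by rw [Real.norm_eq_abs, abs_of_nonneg (M.rev₂_nonneg v)]; exact M.rev₂_le_one v)

theorem integrable_rev (P : Measure Valuation) [IsFiniteMeasure P] : Integrable M.rev P :=
  Integrable.of_bound M.measurable_rev.aestronglyMeasurable 2 (Filter.Eventually.of_forall fun v =>
    by rw [Real.norm_eq_abs, abs_of_nonneg (M.rev_nonneg v)]; exact M.rev_le_two v)

/-! ### Revenue bounds on a square and the trade-off between `Q₁` and `Q₂`. -/

variable {M}

/-- The revenue that can be extracted from an agent with value uniform between `c ≥ d / 2` and `d`
who never wins below `s`. -/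
theorem setIntegral_rev₂_slice_le {c d s : ℝ} (hc : 0 ≤ c) (hd : d ≤ 1) (hcs : c ≤ s)
    (hsd : s ≤ d) (hdc : d ≤ 2 * c) {b : unitInterval}
    (h : ∀ w ∈ valueRange c d, M.alloc (b, w) = 1 → s ≤ w) :
    ∫ w in valueRange c d, M.rev₂ (b, w) ≤ s * (d - s) := by
  by_cases hw : ∃ w ∈ valueRange c d, M.alloc (b, w) = 1
  · obtain ⟨w₀, hw₀, ha⟩ := hw
    set p := M.pay₂ (b, w₀) with hp
    have hp0 : 0 ≤ p := (M.pay₂_mem _).1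
    set m := max p s with hm
    have hmd : m ≤ d := max_le ((pay₂_le_of_alloc ha).trans hw₀.2) hsd
    have hpm : p ≤ m := le_max_left _ _
    have hsm : s ≤ m := le_max_right _ _
    have hle : ∀ w ∈ valueRange c d,
        M.rev₂ (b, w) ≤ (valueRange m d).indicator (fun _ => p) w := fun w hw => by
      rcases M.alloc_zero_or_one (b, w) with h0 | h1
      · simp only [rev₂, h0, zero_mul]
        exact Set.indicator_nonneg (fun _ _ => hp0) w
      · have hpw : M.pay₂ (b, w) = p := pay₂_eq_pay₂ h1 ha
        have : w ∈ valueRange m d := ⟨max_le (hpw ▸ pay₂_le_of_alloc h1) (h w hw h1), hw.2⟩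
        rw [Set.indicator_of_mem this, rev₂, h1, hpw, one_mul]
    have hint : Integrable (fun w => M.rev₂ (b, w))
        ((volume : Measure unitInterval).restrict (valueRange c d)) :=
      Integrable.of_bound (M.measurable_rev₂.comp measurable_prodMk_left).aestronglyMeasurable 1
        (Filter.Eventually.of_forall fun w => by
          rw [Real.norm_eq_abs, abs_of_nonneg (M.rev₂_nonneg _)]; exact M.rev₂_le_one _)
    have hsub : valueRange m d ⊆ valueRange c d := fun w hw =>
      ⟨(hcs.trans hsm).trans hw.1, hw.2⟩
    calc ∫ w in valueRange c d, M.rev₂ (b, w)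
        ≤ ∫ w in valueRange c d, (valueRange m d).indicator (fun _ => p) w :=
          setIntegral_mono_on hint ((integrable_const p).indicator (measurableSet_valueRange _ _))
            (measurableSet_valueRange _ _) hle
      _ = (d - m) * p := by
          rw [setIntegral_indicator (measurableSet_valueRange _ _),
            Set.inter_eq_self_of_subset_right hsub, setIntegral_const,
            volume_real_valueRange ((hc.trans hcs).trans hsm) hmd hd, smul_eq_mul]
      -- Since `p ≤ m`, the left side is at most `m * (d - m)`; the map `x ↦ x * (d - x)` decreases
      -- for `x ≥ d / 2`, and `d / 2 ≤ c ≤ s ≤ m`.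
      _ ≤ s * (d - s) := by nlinarith
  · push Not at hw
    rw [setIntegral_congr_fun (g := fun _ => 0) (measurableSet_valueRange _ _)]
    · simp only [integral_zero]
      exact mul_nonneg (hc.trans hcs) (sub_nonneg.2 hsd)
    · intro w hw'
      simp [rev₂, (M.alloc_zero_or_one (b, w)).resolve_right (hw w hw')]

/-- Only slices with first value at least `s₁` contribute, and each obeys the one-agent bound. -/
theorem setIntegral_rev₂_le {c d s₁ s₂ : ℝ} (hc : 0 ≤ c) (hd : d ≤ 1) (hdc : d ≤ 2 * c)
    (hs₁ : s₁ ∈ Set.Icc c d) (hs₂ : s₂ ∈ Set.Icc c d)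
    (h : ∀ v ∈ valueRange c d ×ˢ valueRange c d, M.alloc v = 1 → s₁ ≤ v.1 ∧ s₂ ≤ v.2) :
    ∫ v in valueRange c d ×ˢ valueRange c d, M.rev₂ v ≤ (d - s₁) * (s₂ * (d - s₂)) := by
  have hJ := measurableSet_valueRange c d
  rw [Measure.volume_eq_prod, setIntegral_prod _ (M.integrable_rev₂ _)]
  have hnn : 0 ≤ s₂ * (d - s₂) := mul_nonneg (hc.trans hs₂.1) (sub_nonneg.2 hs₂.2)
  calc ∫ b in valueRange c d, ∫ w in valueRange c d, M.rev₂ (b, w)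
      ≤ ∫ b in valueRange c d, (valueRange s₁ d).indicator (fun _ => s₂ * (d - s₂)) b := by
        refine setIntegral_mono_on ?_
          ((integrable_const _).indicator (measurableSet_valueRange _ _)) hJ fun b hb => ?_
        · have hi : Integrable M.rev₂ ((volume.restrict (valueRange c d)).prod
            (volume.restrict (valueRange c d))) := M.integrable_rev₂ _
          exact hi.integral_prod_left
        · by_cases hs : s₁ ≤ b
          · rw [Set.indicator_of_mem (show b ∈ valueRange s₁ d from ⟨hs, hb.2⟩)]
            exact setIntegral_rev₂_slice_le hc hd hs₂.1 hs₂.2 hdc fun w hw ha =>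
              (h (b, w) ⟨hb, hw⟩ ha).2
          · rw [Set.indicator_of_notMem (fun hb' : b ∈ valueRange s₁ d => hs hb'.1),
              setIntegral_congr_fun (g := fun _ => 0) hJ]
            · simp
            · intro w hw
              have : M.alloc (b, w) = 0 := (M.alloc_zero_or_one (b, w)).resolve_right
                fun ha => hs (h (b, w) ⟨hb, hw⟩ ha).1
              simp [rev₂, this]
    _ = (d - s₁) * (s₂ * (d - s₂)) := by
        have hsub : valueRange s₁ d ⊆ valueRange c d := fun w hw => ⟨hs₁.1.trans hw.1, hw.2⟩
        rw [setIntegral_indicator (measurableSet_valueRange _ _),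
          Set.inter_eq_self_of_subset_right hsub, setIntegral_const,
          volume_real_valueRange (hc.trans hs₁.1) hs₁.2 hd, smul_eq_mul]

/-- The bounds for the two agents, the first obtained through `swap`, share the factor `(d - s₁) *
(d - s₂)`. -/
theorem setIntegral_rev_le {c d s₁ s₂ : ℝ} (hc : 0 ≤ c) (hd : d ≤ 1) (hdc : d ≤ 2 * c)
    (hs₁ : s₁ ∈ Set.Icc c d) (hs₂ : s₂ ∈ Set.Icc c d)
    (h : ∀ v ∈ valueRange c d ×ˢ valueRange c d, M.alloc v = 1 → s₁ ≤ v.1 ∧ s₂ ≤ v.2) :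
    ∫ v in valueRange c d ×ˢ valueRange c d, M.rev v ≤ (s₁ + s₂) * ((d - s₁) * (d - s₂)) := by
  have h2 := setIntegral_rev₂_le hc hd hdc hs₁ hs₂ h
  have h1 := setIntegral_rev₂_le (M := M.swap) hc hd hdc hs₂ hs₁ fun v hv ha =>
    (h v.swap ⟨hv.2, hv.1⟩ ha).symm
  have hsw : ∫ v in valueRange c d ×ˢ valueRange c d, M.swap.rev₂ v.swap
      = ∫ v in valueRange c d ×ˢ valueRange c d, M.swap.rev₂ v := by
    rw [Measure.volume_eq_prod]
    exact setIntegral_prod_swap (μ := (volume : Measure unitInterval))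
      (ν := (volume : Measure unitInterval)) _ _ M.swap.rev₂
  have hi : Integrable (fun v : Valuation => M.swap.rev₂ v.swap)
      (volume.restrict (valueRange c d ×ˢ valueRange c d)) :=
    Integrable.of_bound (M.swap.measurable_rev₂.comp measurable_swap).aestronglyMeasurable 1
      (Filter.Eventually.of_forall fun v => by
        rw [Real.norm_eq_abs, abs_of_nonneg (M.swap.rev₂_nonneg _)]; exact M.swap.rev₂_le_one _)
  simp_rw [rev_eq]
  rw [integral_add hi (M.integrable_rev₂ _), hsw]
  linarith

variable (M)

/-- The expected revenue on the uniform distribution on `Q₁`. -/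
noncomputable def lowRev : ℝ := 16 * ∫ v in Q₁, M.rev v

/-- The expected revenue on the uniform distribution on `Q₂`. -/
noncomputable def highRev : ℝ := 16 * ∫ v in Q₂, M.rev v

theorem lowRev_nonneg : 0 ≤ M.lowRev :=
  mul_nonneg (by norm_num) (integral_nonneg M.rev_nonneg)

/-- The trade-off between the revenues on the two squares. -/
theorem lowRev_le_one_and_tradeoff : M.lowRev ≤ 1 ∧ M.lowRev + 2 * M.highRev ≤ 3 := by
  by_cases hA : ∃ v ∈ Q₁, M.alloc v = 1
  · obtain ⟨v₀, hv₀, ha₀⟩ := hA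
    -- The coordinatewise infima of `A` play a double role: nobody wins below them inside `Q₁`, and
    -- they cap the payments on `Q₂`, which dominates `Q₁`.
    set A : Set Valuation := {v | v ∈ Q₁ ∧ M.alloc v = 1} with hAdef
    set S₁ : Set ℝ := (fun v : Valuation => (v.1 : ℝ)) '' A with hS₁
    set S₂ : Set ℝ := (fun v : Valuation => (v.2 : ℝ)) '' A with hS₂
    have hne₁ : S₁.Nonempty := ⟨_, v₀, ⟨hv₀, ha₀⟩, rfl⟩
    have hne₂ : S₂.Nonempty := ⟨_, v₀, ⟨hv₀, ha₀⟩, rfl⟩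
    have hlb₁ : ∀ x ∈ S₁, 1 / 2 ≤ x := by rintro x ⟨v, ⟨hv, -⟩, rfl⟩; exact hv.1.1
    have hlb₂ : ∀ x ∈ S₂, 1 / 2 ≤ x := by rintro x ⟨v, ⟨hv, -⟩, rfl⟩; exact hv.2.1
    have hle₁ : ∀ v ∈ A, sInf S₁ ≤ v.1 := fun v hv => csInf_le ⟨1 / 2, hlb₁⟩ ⟨v, hv, rfl⟩
    have hle₂ : ∀ v ∈ A, sInf S₂ ≤ v.2 := fun v hv => csInf_le ⟨1 / 2, hlb₂⟩ ⟨v, hv, rfl⟩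
    have hs₁ : sInf S₁ ∈ Set.Icc (1 / 2 : ℝ) (3 / 4) :=
      ⟨le_csInf hne₁ hlb₁, (hle₁ v₀ ⟨hv₀, ha₀⟩).trans hv₀.1.2⟩
    have hs₂ : sInf S₂ ∈ Set.Icc (1 / 2 : ℝ) (3 / 4) :=
      ⟨le_csInf hne₂ hlb₂, (hle₂ v₀ ⟨hv₀, ha₀⟩).trans hv₀.2.2⟩
    have hlow : M.lowRev
        ≤ 16 * ((sInf S₁ + sInf S₂) * ((3 / 4 - sInf S₁) * (3 / 4 - sInf S₂))) :=
      mul_le_mul_of_nonneg_left (setIntegral_rev_le (by norm_num) (by norm_num) (by norm_num)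
        hs₁ hs₂ fun v hv ha => ⟨hle₁ v ⟨hv, ha⟩, hle₂ v ⟨hv, ha⟩⟩) (by norm_num)
    have hpt : ∀ v ∈ Q₂, M.rev v ≤ sInf S₁ + sInf S₂ := fun v hv => by
      have hle : ∀ q ∈ A, q ≤ v := fun q hq =>
        ⟨Subtype.coe_le_coe.1 (hq.1.1.2.trans hv.1.1), Subtype.coe_le_coe.1 (hq.1.2.2.trans hv.2.1)⟩
      have ha : M.alloc v = 1 := alloc_mono (hle v₀ ⟨hv₀, ha₀⟩) ha₀
      have h1 : M.pay₁ v ≤ sInf S₁ := le_csInf hne₁ (by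
        rintro x ⟨q, hq, rfl⟩
        exact pay₂_le_of_le (M := M.swap) (v := q.swap) (v' := v.swap)
          (Prod.swap_le_swap.2 (hle q hq)) hq.2)
      have h2 : M.pay₂ v ≤ sInf S₂ := le_csInf hne₂ (by
        rintro x ⟨q, hq, rfl⟩
        exact pay₂_le_of_le (hle q hq) hq.2)
      rw [rev, ha]; linarith
    have hhigh : M.highRev ≤ sInf S₁ + sInf S₂ := by
      have := setIntegral_mono_on (μ := (volume : Measure Valuation))
        (M.integrable_rev _) (integrable_const (sInf S₁ + sInf S₂))
        measurableSet_Q₂ hpt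
      rw [setIntegral_const, volume_real_Q₂, smul_eq_mul] at this
      rw [highRev]; linarith
    generalize sInf S₁ = x at *
    generalize sInf S₂ = y at *
    obtain ⟨hx, hx'⟩ := hs₁
    obtain ⟨hy, hy'⟩ := hs₂
    -- With `S = x + y ≥ 1` this is `(2 * S - 1) * (S - 1) ≥ 0`. Together with AM-GM it yields
    -- `lowRev ≤ 3 - 2 * S`, while `highRev ≤ S`.
    have hS : 2 * (x + y) * (3 / 2 - (x + y)) ≤ 1 := by nlinarith
    have hprod : (3 / 4 - x) * (3 / 4 - y) ≤ (3 / 2 - (x + y)) ^ 2 / 4 := by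
      nlinarith [sq_nonneg (x - y)]
    have hkey : 16 * ((x + y) * ((3 / 4 - x) * (3 / 4 - y))) ≤ 2 * (3 / 2 - (x + y)) := by
      have h1 := mul_le_mul_of_nonneg_left hprod (show 0 ≤ x + y by linarith)
      have h2 := mul_le_mul_of_nonneg_left hS (show 0 ≤ 3 / 2 - (x + y) by linarith)
      nlinarith
    constructor <;> linarith
  · push Not at hA
    have hlow : M.lowRev = 0 := by
      rw [lowRev, setIntegral_congr_fun (g := fun _ => 0) measurableSet_Q₁]
      · simp
      · intro v hv
        simp [rev, (M.alloc_zero_or_one v).resolve_right (hA v hv)]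
    -- Without sales on `Q₁`, the best on `Q₂` is to sell always at its lower corner, for revenue
    -- `3/2`.
    have hhigh : M.highRev
        ≤ 16 * ((3 / 4 + 3 / 4 : ℝ) * ((1 - 3 / 4) * (1 - 3 / 4))) :=
      mul_le_mul_of_nonneg_left (setIntegral_rev_le (by norm_num) le_rfl (by norm_num)
        ⟨le_rfl, by norm_num⟩ ⟨le_rfl, by norm_num⟩ fun v hv _ => ⟨hv.1.1, hv.2.1⟩) (by norm_num)
    constructor <;> linarith

end Mechanism

/-! ### Posted prices, the benchmark mechanisms. -/

open Classical in
/-- The mechanism that offers the good to each agent for the price `r`. -/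
noncomputable def postedPrice (r : unitInterval) : Mechanism where
  alloc v := if r ≤ v.1 ∧ r ≤ v.2 then 1 else 0
  pay₁ v := if r ≤ v.1 ∧ r ≤ v.2 then r else 0
  pay₂ v := if r ≤ v.1 ∧ r ≤ v.2 then r else 0
  alloc_zero_or_one v := by split_ifs <;> simp
  pay₁_mem v := by split_ifs; exacts [r.2, ⟨le_rfl, zero_le_one⟩]
  pay₂_mem v := by split_ifs; exacts [r.2, ⟨le_rfl, zero_le_one⟩]
  dsic₁ w b₁ b₂ := by
    simp only [← Subtype.coe_le_coe]
    split_ifs with h1 h2 h2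
    · linarith
    · have : (w : ℝ) < r := by simp_all
      linarith
    · linarith [h2.1, h2.2]
    · linarith
  dsic₂ w b₁ b₂ := by
    simp only [← Subtype.coe_le_coe]
    split_ifs with h1 h2 h2
    · linarith
    · have : (w : ℝ) < r := by simp_all
      linarith
    · linarith [h2.1, h2.2]
    · linarith
  ir₁ w b := by
    simp only [← Subtype.coe_le_coe]
    split_ifs with h <;> simp_all
  ir₂ w b := by
    simp only [← Subtype.coe_le_coe]
    split_ifs with h <;> simp_all
  isClosed_region := by
    have : {v : Valuation | (if r ≤ v.1 ∧ r ≤ v.2 then (1 : ℝ) else 0) = 1}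
        = Set.Ici r ×ˢ Set.Ici r := by
      ext v; simp [Prod.le_def]
    rw [this]
    exact isClosed_Ici.prod isClosed_Ici

theorem rev_postedPrice {r : unitInterval} {v : Valuation} (h₁ : r ≤ v.1) (h₂ : r ≤ v.2) :
    (postedPrice r).rev v = 2 * r := by
  simp [postedPrice, Mechanism.rev, h₁, h₂, two_mul]

theorem lowRev_postedPrice {r : unitInterval} (hr : (r : ℝ) ≤ 1 / 2) :
    (postedPrice r).lowRev = 2 * r := by
  rw [Mechanism.lowRev, setIntegral_congr_fun (g := fun _ => 2 * (r : ℝ)) measurableSet_Q₁]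
  · rw [setIntegral_const, volume_real_Q₁, smul_eq_mul]; ring
  · exact fun v hv => rev_postedPrice (Subtype.coe_le_coe.1 (hr.trans hv.1.1))
      (Subtype.coe_le_coe.1 (hr.trans hv.2.1))

theorem highRev_postedPrice {r : unitInterval} (hr : (r : ℝ) ≤ 3 / 4) :
    (postedPrice r).highRev = 2 * r := by
  rw [Mechanism.highRev, setIntegral_congr_fun (g := fun _ => 2 * (r : ℝ)) measurableSet_Q₂]
  · rw [setIntegral_const, volume_real_Q₂, smul_eq_mul]; ring
  · exact fun v hv => rev_postedPrice (Subtype.coe_le_coe.1 (hr.trans hv.1.1))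
      (Subtype.coe_le_coe.1 (hr.trans hv.2.1))

/-! ### The mixtures: smoothness and closeness of their products. -/

section SquareMixture

theorem volume_Q₁_inter_Q₂ : (volume : Measure Valuation) (Q₁ ∩ Q₂) = 0 := by
  set a : unitInterval := ⟨3 / 4, by norm_num, by norm_num⟩ with ha
  have hsub : Q₁ ∩ Q₂ ⊆ {a} ×ˢ {a} := fun v hv =>
    ⟨Subtype.ext (le_antisymm hv.1.1.2 hv.2.1.1), Subtype.ext (le_antisymm hv.1.2.2 hv.2.2.1)⟩
  refine measure_mono_null hsub ?_
  rw [Measure.volume_eq_prod, Measure.prod_prod]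
  simp

theorem squareMixture_eq {α : ℝ} (h0 : 0 ≤ α) (h1 : α ≤ 1) :
    squareMixture α = ENNReal.ofReal (16 * α) • (volume : Measure Valuation).restrict Q₁
      + ENNReal.ofReal (16 * (1 - α)) • (volume : Measure Valuation).restrict Q₂ := by
  have hd : (fun v => ENNReal.ofReal (16 * (α * Q₁.indicator (fun _ => (1 : ℝ)) v
      + (1 - α) * Q₂.indicator (fun _ => (1 : ℝ)) v)))
      = Q₁.indicator (fun _ => ENNReal.ofReal (16 * α))
        + Q₂.indicator (fun _ => ENNReal.ofReal (16 * (1 - α))) := by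
    funext v
    have h2 : 0 ≤ 1 - α := sub_nonneg.2 h1
    by_cases hv₁ : v ∈ Q₁ <;> by_cases hv₂ : v ∈ Q₂
    · simp only [Pi.add_apply, Set.indicator_of_mem hv₁, Set.indicator_of_mem hv₂]
      rw [← ENNReal.ofReal_add (by positivity) (by positivity)]
      congr 1; ring
    all_goals simp [hv₁, hv₂]
  rw [squareMixture, hd, withDensity_add_left (measurable_const.indicator measurableSet_Q₁),
    withDensity_indicator measurableSet_Q₁, withDensity_indicator measurableSet_Q₂,
    withDensity_const, withDensity_const]

theorem volume_Q₁ : (volume : Measure Valuation) Q₁ = ENNReal.ofReal (1 / 16) := by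
  rw [← volume_real_Q₁, ofReal_measureReal]

theorem volume_Q₂ : (volume : Measure Valuation) Q₂ = ENNReal.ofReal (1 / 16) := by
  rw [← volume_real_Q₂, ofReal_measureReal]

theorem isProbabilityMeasure_squareMixture {α : ℝ} (h0 : 0 ≤ α) (h1 : α ≤ 1) :
    IsProbabilityMeasure (squareMixture α) := by
  have h2 : 0 ≤ 1 - α := sub_nonneg.2 h1
  refine ⟨?_⟩
  rw [squareMixture_eq h0 h1]
  simp only [Measure.add_apply, Measure.smul_apply, smul_eq_mul, Measure.restrict_apply_univ,
    volume_Q₁, volume_Q₂]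
  rw [← ENNReal.ofReal_mul (by positivity), ← ENNReal.ofReal_mul (by positivity),
    ← ENNReal.ofReal_add (by positivity) (by positivity), ← ENNReal.ofReal_one]
  congr 1; ring

/-- Off the null overlap of the squares the density is at most `16 * (3/4) = 12`. -/
theorem isSmooth_squareMixture {α σ : ℝ} (hσ : 0 < σ) (hσ' : σ ≤ 1 / 12) (h0 : 1 / 4 ≤ α)
    (h1 : α ≤ 3 / 4) : IsSmooth σ (squareMixture α) := by
  intro s hs
  have h12 : ∀ c : ℝ, c ≤ 12 → ENNReal.ofReal c ≤ (ENNReal.ofReal σ)⁻¹ := fun c hc => by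
    rw [← ENNReal.ofReal_inv_of_pos hσ]
    refine ENNReal.ofReal_le_ofReal (hc.trans ?_)
    rw [le_inv_comm₀ (by norm_num) hσ]
    linarith
  have hunion : volume (s ∩ Q₁) + volume (s ∩ Q₂) ≤ (volume : Measure Valuation) s := by
    rw [← measure_union₀ (hs.inter measurableSet_Q₂).nullMeasurableSet
      (measure_mono_null (fun v hv => Set.mem_inter hv.1.2 hv.2.2) volume_Q₁_inter_Q₂)]
    exact measure_mono (Set.union_subset Set.inter_subset_left Set.inter_subset_left)
  rw [squareMixture_eq (by linarith) (by linarith)]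
  simp only [Measure.add_apply, Measure.smul_apply, smul_eq_mul, Measure.restrict_apply hs]
  calc _ ≤ (ENNReal.ofReal σ)⁻¹ * volume (s ∩ Q₁) + (ENNReal.ofReal σ)⁻¹ * volume (s ∩ Q₂) :=
        add_le_add (mul_le_mul_left (h12 _ (by linarith)) _)
          (mul_le_mul_left (h12 _ (by linarith)) _)
    _ ≤ (ENNReal.ofReal σ)⁻¹ * volume s := by
        rw [← mul_add]; exact mul_le_mul_right hunion _
    _ = volume s / ENNReal.ofReal σ := by rw [mul_comm, div_eq_mul_inv]

theorem integral_squareMixture {α : ℝ} (h0 : 0 ≤ α) (h1 : α ≤ 1) {f : Valuation → ℝ}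
    (hf₁ : IntegrableOn f Q₁) (hf₂ : IntegrableOn f Q₂) :
    ∫ v, f v ∂(squareMixture α) = α * (16 * ∫ v in Q₁, f v) + (1 - α) * (16 * ∫ v in Q₂, f v) := by
  rw [squareMixture_eq h0 h1, integral_add_measure (hf₁.smul_measure ENNReal.ofReal_ne_top)
    (hf₂.smul_measure ENNReal.ofReal_ne_top), integral_smul_measure, integral_smul_measure,
    ENNReal.toReal_ofReal (by linarith), ENNReal.toReal_ofReal (by linarith), smul_eq_mul,
    smul_eq_mul]
  ring

theorem integral_rev_squareMixture {α : ℝ} (h0 : 0 ≤ α) (h1 : α ≤ 1) (M : Mechanism) :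
    ∫ v, M.rev v ∂(squareMixture α) = α * M.lowRev + (1 - α) * M.highRev :=
  integral_squareMixture h0 h1 (M.integrable_rev _) (M.integrable_rev _)

open Classical in
/-- The direction in which the density of `squareMixture α` with respect to `squareMixture (1 / 3)`
moves with `α`. -/
noncomputable def score (v : Valuation) : ℝ := if v ∈ Q₁ then 3 else -3 / 2

theorem measurable_score : Measurable score :=
  Measurable.ite measurableSet_Q₁ measurable_const measurable_const

theorem score_of_mem {v : Valuation} (hv : v ∈ Q₁) : score v = 3 := if_pos hv

theorem score_of_notMem {v : Valuation} (hv : v ∉ Q₁) : score v = -3 / 2 := if_neg hv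

theorem score_ae_eq_on_Q₁ : ∀ᵐ v ∂(volume : Measure Valuation).restrict Q₁, score v = 3 :=
  (ae_restrict_iff' measurableSet_Q₁).2 (Filter.Eventually.of_forall fun _ => score_of_mem)

theorem score_ae_eq_on_Q₂ : ∀ᵐ v ∂(volume : Measure Valuation).restrict Q₂, score v = -3 / 2 := by
  rw [ae_restrict_iff' measurableSet_Q₂]
  have : ∀ᵐ v : Valuation, v ∉ Q₁ ∩ Q₂ := measure_eq_zero_iff_ae_notMem.1 volume_Q₁_inter_Q₂
  filter_upwards [this] with v hv hv₂
  exact score_of_notMem fun hv₁ => hv ⟨hv₁, hv₂⟩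

theorem integral_comp_score {φ : ℝ → ℝ} :
    ∫ v, φ (score v) ∂(squareMixture (1 / 3)) = φ 3 / 3 + 2 * φ (-3 / 2) / 3 := by
  have e₁ : (fun v => φ (score v)) =ᵐ[volume.restrict Q₁] fun _ => φ 3 := by
    filter_upwards [score_ae_eq_on_Q₁] with v hv
    rw [hv]
  have e₂ : (fun v => φ (score v)) =ᵐ[volume.restrict Q₂] fun _ => φ (-3 / 2) := by
    filter_upwards [score_ae_eq_on_Q₂] with v hv
    rw [hv]
  rw [integral_squareMixture (by norm_num) (by norm_num) ((integrable_const _).congr e₁.symm)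
    ((integrable_const _).congr e₂.symm), integral_congr_ae e₁, integral_congr_ae e₂,
    setIntegral_const, setIntegral_const, volume_real_Q₁, volume_real_Q₂, smul_eq_mul, smul_eq_mul]
  ring

/-- The weights factor as `1/3 + e = 1/3 * (1 + 3 * e)` and `2/3 - e = 2/3 * (1 - 3/2 * e)`. -/
theorem squareMixture_eq_withDensity {e : ℝ} (h0 : -(1 / 3) ≤ e) (h1 : e ≤ 2 / 3) :
    squareMixture (1 / 3 + e)
      = (squareMixture (1 / 3)).withDensity fun v => ENNReal.ofReal (1 + e * score v) := by
  have e₁ : (fun v => ENNReal.ofReal (1 + e * score v)) =ᵐ[volume.restrict Q₁]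
      fun _ => ENNReal.ofReal (1 + e * 3) := by
    filter_upwards [score_ae_eq_on_Q₁] with v hv
    rw [hv]
  have e₂ : (fun v => ENNReal.ofReal (1 + e * score v)) =ᵐ[volume.restrict Q₂]
      fun _ => ENNReal.ofReal (1 + e * (-3 / 2)) := by
    filter_upwards [score_ae_eq_on_Q₂] with v hv
    rw [hv]
  rw [squareMixture_eq (by linarith) (by linarith), squareMixture_eq (by norm_num) (by norm_num),
    withDensity_add_measure, withDensity_smul_measure, withDensity_smul_measure,
    withDensity_congr_ae e₁, withDensity_congr_ae e₂, withDensity_const, withDensity_const,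
    smul_smul, smul_smul, ← ENNReal.ofReal_mul (by norm_num), ← ENNReal.ofReal_mul (by norm_num)]
  congr 3 <;> ring_nf

/-- After `n` rounds the laws of the history for the mixture weights `1 / 3 ± ε` are still close if
`144 n ε² ≤ 1`. -/
theorem integral_pi_squareMixture_sub_le {ι : Type*} [Fintype ι] {ε : ℝ} (h0 : 0 < ε)
    (h1 : ε ≤ 1 / 3) (hn : Fintype.card ι * (144 * ε ^ 2) ≤ 1) {g : (ι → Valuation) → ℝ}
    (hg : Measurable g) (hg0 : ∀ x, 0 ≤ g x) (hg1 : ∀ x, g x ≤ 1) :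
    ∫ x, g x ∂(Measure.pi fun _ : ι => squareMixture (1 / 3 + ε))
      - ∫ x, g x ∂(Measure.pi fun _ : ι => squareMixture (1 / 3 - ε)) ≤ 1 / 4 := by
  have hp := isProbabilityMeasure_squareMixture (α := 1 / 3) (by norm_num) (by norm_num)
  have hp₁ := isProbabilityMeasure_squareMixture (α := 1 / 3 + ε) (by linarith) (by linarith)
  have hp₂ := isProbabilityMeasure_squareMixture (α := 1 / 3 - ε) (by linarith) (by linarith)
  have d₁ := squareMixture_eq_withDensity (e := ε) (by linarith) (by linarith)
  have d₂ := squareMixture_eq_withDensity (e := -ε) (by linarith) (by linarith)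
  simp only [neg_mul, ← sub_eq_add_neg] at d₂
  rw [d₁] at hp₁
  rw [d₂] at hp₂
  rw [d₁, d₂]
  have hv : ∀ v, score v = 3 ∨ score v = -3 / 2 := fun v => by
    by_cases h : v ∈ Q₁
    · exact Or.inl (score_of_mem h)
    · exact Or.inr (score_of_notMem h)
  -- The variance of `score` is `9/3 + 2/3 * (9/4) = 9/2`, and `32 * (9/2) = 144`.
  refine integral_pi_withDensity_sub_le (κ := 9 / 2) _ measurable_score (fun v => ?_) (fun v => ?_)
    h0.ne' ?_ ?_ ?_ hg hg0 hg1
  · rcases hv v with h | h <;> rw [h] <;> linarith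
  · rcases hv v with h | h <;> rw [h] <;> linarith
  · rw [integral_comp_score (φ := fun x => x)]; norm_num
  · rw [integral_comp_score (φ := fun x => x ^ 2)]; norm_num
  · linarith

end SquareMixture

/-! ### Per-round regret and the two-point argument. -/

section Regret

variable {Ω : Type*} [MeasurableSpace Ω] (μ : Measure Ω) (A : LearningAlgorithm Ω)

theorem measurable_rev_play {T : ℕ} (t : Fin T) :
    Measurable fun z : Ω × (Fin T → Valuation) => (A.play z.1 z.2 t).rev (z.2 t) :=
  (A.measurable_rev t).comp (g := fun z : Ω × (Fin t → Valuation) × Valuation =>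
    (A.mech t z.1 z.2.1).rev z.2.2) (f := fun z : Ω × (Fin T → Valuation) =>
    (z.1, (fun s => z.2 (Fin.castLE t.isLt.le s)), z.2 t)) (by fun_prop)

theorem measurable_lowRev_mech (t : ℕ) :
    Measurable fun p : Ω × (Fin t → Valuation) => (A.mech t p.1 p.2).lowRev := by
  have hF : Measurable fun q : (Ω × (Fin t → Valuation)) × Valuation =>
      (A.mech t q.1.1 q.1.2).rev q.2 :=
    (A.measurable_rev t).comp MeasurableEquiv.prodAssoc.measurable
  exact (hF.stronglyMeasurable.integral_prod_right (ν := volume.restrict Q₁)).measurable.const_mul 16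

/-- The share of the revenue on `Q₁` that the algorithm secures in round `t` after the given
valuations, averaged over its internal randomness. -/
noncomputable def lowShare (t : ℕ) (h : Fin t → Valuation) : ℝ :=
  ∫ ω, (A.mech t ω h).lowRev ∂μ

theorem lowShare_nonneg (t : ℕ) (h : Fin t → Valuation) : 0 ≤ lowShare μ A t h :=
  integral_nonneg fun _ => Mechanism.lowRev_nonneg _

theorem integrable_lowRev_mech (t : ℕ) (P : Measure (Ω × (Fin t → Valuation)))
    [IsFiniteMeasure P] : Integrable (fun p => (A.mech t p.1 p.2).lowRev) P :=
  Integrable.of_bound (measurable_lowRev_mech A t).aestronglyMeasurable 1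
    (Filter.Eventually.of_forall fun p => by
      rw [Real.norm_eq_abs, abs_of_nonneg (Mechanism.lowRev_nonneg _)]
      exact (Mechanism.lowRev_le_one_and_tradeoff _).1)

variable [IsProbabilityMeasure μ]

theorem measurable_lowShare (t : ℕ) : Measurable (lowShare μ A t) :=
  ((measurable_lowRev_mech A t).stronglyMeasurable.integral_prod_left (μ := μ)).measurable

/-- The mechanism of round `t` is fixed before the independent valuation of that round is drawn. -/
theorem integral_rev_play (ν : Measure Valuation) [IsProbabilityMeasure ν] {T : ℕ} (t : Fin T) :
    ∫ z : Ω × (Fin T → Valuation), (A.play z.1 z.2 t).rev (z.2 t)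
        ∂(μ.prod (Measure.pi fun _ => ν))
      = ∫ p : Ω × (Fin t → Valuation), (∫ v, (A.mech t p.1 p.2).rev v ∂ν)
        ∂(μ.prod (Measure.pi fun _ => ν)) := by
  set F : (Ω × (Fin t → Valuation)) × Valuation → ℝ := fun q => (A.mech t q.1.1 q.1.2).rev q.2
  have hF : Measurable F := (A.measurable_rev t).comp MeasurableEquiv.prodAssoc.measurable
  have hmp := (measurePreserving_prodAssoc μ (Measure.pi fun _ : Fin t => ν) ν).symm.comp
    ((MeasurePreserving.id μ).prod (measurePreserving_past_present ν t))
  have hint : Integrable F ((μ.prod (Measure.pi fun _ : Fin t => ν)).prod ν) :=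
    Integrable.of_bound hF.aestronglyMeasurable 2 (Filter.Eventually.of_forall fun q => by
      rw [Real.norm_eq_abs, abs_of_nonneg (Mechanism.rev_nonneg _ _)]
      exact Mechanism.rev_le_two _ _)
  rw [← integral_prod F hint, ← hmp.map_eq, integral_map hmp.measurable.aemeasurable
    hF.aestronglyMeasurable]
  rfl

theorem lowShare_le_one (t : ℕ) (h : Fin t → Valuation) : lowShare μ A t h ≤ 1 := by
  have hi : Integrable (fun ω => (A.mech t ω h).lowRev) μ :=
    Integrable.of_bound ((measurable_lowRev_mech A t).comp
      measurable_prodMk_right).aestronglyMeasurable 1 (Filter.Eventually.of_forall fun p => by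
      rw [Real.norm_eq_abs, abs_of_nonneg (Mechanism.lowRev_nonneg _)]
      exact (Mechanism.lowRev_le_one_and_tradeoff _).1)
  refine (integral_mono hi (integrable_const 1)
    fun ω => (Mechanism.lowRev_le_one_and_tradeoff _).1).trans ?_
  simp

/-- Substituting `highRev ≤ (3 - lowRev) / 2`, whose weight `2/3 - e` is nonnegative, into the
revenue gives the bound for either sign of `e`. -/
theorem integral_rev_play_le {e : ℝ} (h0 : -(1 / 3) ≤ e) (h1 : e ≤ 2 / 3) {T : ℕ} (t : Fin T) :
    ∫ z : Ω × (Fin T → Valuation), (A.play z.1 z.2 t).rev (z.2 t)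
        ∂(μ.prod (Measure.pi fun _ => squareMixture (1 / 3 + e)))
      ≤ 1 - 3 / 2 * e * (1 - ∫ h, lowShare μ A t h
        ∂(Measure.pi fun _ : Fin t => squareMixture (1 / 3 + e))) := by
  have hp := isProbabilityMeasure_squareMixture (α := 1 / 3 + e) (by linarith) (by linarith)
  set ν := squareMixture (1 / 3 + e) with hν
  have hint := integrable_lowRev_mech A t (μ.prod (Measure.pi fun _ : Fin t => ν))
  rw [integral_rev_play]
  have hF : Measurable fun q : (Ω × (Fin t → Valuation)) × Valuation =>
      (A.mech t q.1.1 q.1.2).rev q.2 :=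
    (A.measurable_rev t).comp MeasurableEquiv.prodAssoc.measurable
  have hi : Integrable (fun q : (Ω × (Fin t → Valuation)) × Valuation =>
      (A.mech t q.1.1 q.1.2).rev q.2) ((μ.prod (Measure.pi fun _ : Fin t => ν)).prod ν) :=
    Integrable.of_bound hF.aestronglyMeasurable 2 (Filter.Eventually.of_forall fun q => by
      rw [Real.norm_eq_abs, abs_of_nonneg (Mechanism.rev_nonneg _ _)]
      exact Mechanism.rev_le_two _ _)
  have hshare : ∫ h, lowShare μ A t h ∂(Measure.pi fun _ : Fin t => ν)
      = ∫ p, (A.mech t p.1 p.2).lowRev ∂(μ.prod (Measure.pi fun _ : Fin t => ν)) :=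
    (integral_prod_symm _ hint).symm
  have hmono := integral_mono hi.integral_prod_left
    ((integrable_const (1 - 3 / 2 * e)).add (hint.const_mul (3 / 2 * e))) fun p => ?_
  · refine hmono.trans (le_of_eq ?_)
    simp only [Pi.add_apply]
    rw [integral_add (integrable_const _) (hint.const_mul _), integral_const_mul, hshare]
    simp only [integral_const, probReal_univ, smul_eq_mul]
    ring
  · change ∫ v, (A.mech t p.1 p.2).rev v ∂ν
      ≤ 1 - 3 / 2 * e + 3 / 2 * e * (A.mech t p.1 p.2).lowRev
    rw [hν, integral_rev_squareMixture (by linarith) (by linarith)]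
    have := (Mechanism.lowRev_le_one_and_tradeoff (A.mech t p.1 p.2)).2
    nlinarith

theorem sum_le_regretAgainst (ν : Measure Valuation) [IsProbabilityMeasure ν] {T : ℕ}
    (M : Mechanism) {c : Fin T → ℝ} (hc : ∀ t, c t ≤ ∫ v, M.rev v ∂ν
      - ∫ z : Ω × (Fin T → Valuation), (A.play z.1 z.2 t).rev (z.2 t)
        ∂(μ.prod (Measure.pi fun _ => ν))) :
    ((∑ t, c t : ℝ) : EReal) ≤ regretAgainst μ A T (Measure.pi fun _ => ν) := by
  refine le_iSup_of_le M (EReal.coe_le_coe_iff.2 ?_)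
  have hmp : ∀ t : Fin T, MeasurePreserving (fun z : Ω × (Fin T → Valuation) => z.2 t)
      (μ.prod (Measure.pi fun _ => ν)) ν := fun t =>
    (measurePreserving_eval (fun _ : Fin T => ν) t).comp measurePreserving_snd
  have i₁ : ∀ t : Fin T, Integrable (fun z : Ω × (Fin T → Valuation) => M.rev (z.2 t))
      (μ.prod (Measure.pi fun _ => ν)) := fun t =>
    (hmp t).integrable_comp_of_integrable (M.integrable_rev ν)
  have i₂ : ∀ t : Fin T, Integrable (fun z : Ω × (Fin T → Valuation) =>
      (A.play z.1 z.2 t).rev (z.2 t)) (μ.prod (Measure.pi fun _ => ν)) := fun t =>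
    Integrable.of_bound (measurable_rev_play A t).aestronglyMeasurable 2
      (Filter.Eventually.of_forall fun q => by
        rw [Real.norm_eq_abs, abs_of_nonneg (Mechanism.rev_nonneg _ _)]
        exact Mechanism.rev_le_two _ _)
  rw [integral_sub (integrable_finsetSum _ fun t _ => i₁ t)
    (integrable_finsetSum _ fun t _ => i₂ t), integral_finsetSum _ fun t _ => i₁ t,
    integral_finsetSum _ fun t _ => i₂ t, ← Finset.sum_sub_distrib]
  refine Finset.sum_le_sum fun t _ => (hc t).trans (le_of_eq ?_)
  congr 1
  have := integral_map (μ := μ.prod (Measure.pi fun _ : Fin T => ν)) (hmp t).measurable.aemeasurable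
    (M.measurable_rev.aestronglyMeasurable (μ := Measure.map _ _))
  rwa [(hmp t).map_eq] at this

theorem regretAgainst_squareMixture_add {ε : ℝ} (h0 : 0 ≤ ε) (h1 : ε ≤ 2 / 3) (T : ℕ) :
    ((∑ t : Fin T, 3 / 2 * ε * (1 - ∫ h, lowShare μ A t h
        ∂(Measure.pi fun _ : Fin t => squareMixture (1 / 3 + ε))) : ℝ) : EReal)
      ≤ regretAgainst μ A T (Measure.pi fun _ => squareMixture (1 / 3 + ε)) := by
  have hp := isProbabilityMeasure_squareMixture (α := 1 / 3 + ε) (by linarith) (by linarith)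
  refine sum_le_regretAgainst μ A _ (postedPrice ⟨1 / 2, by norm_num, by norm_num⟩) fun t => ?_
  have h := integral_rev_play_le μ A (e := ε) (by linarith) h1 t
  rw [integral_rev_squareMixture (by linarith) (by linarith), lowRev_postedPrice le_rfl,
    highRev_postedPrice (by norm_num)]
  linarith

theorem regretAgainst_squareMixture_sub {ε : ℝ} (h0 : 0 ≤ ε) (h1 : ε ≤ 1 / 3) (T : ℕ) :
    ((∑ t : Fin T, 3 / 2 * ε * ∫ h, lowShare μ A t h
        ∂(Measure.pi fun _ : Fin t => squareMixture (1 / 3 - ε)) : ℝ) : EReal)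
      ≤ regretAgainst μ A T (Measure.pi fun _ => squareMixture (1 / 3 - ε)) := by
  have hp := isProbabilityMeasure_squareMixture (α := 1 / 3 - ε) (by linarith) (by linarith)
  set M := postedPrice ⟨3 / 4, by norm_num, by norm_num⟩ with hM
  refine sum_le_regretAgainst μ A _ M fun t => ?_
  have h := integral_rev_play_le μ A (e := -ε) (by linarith) (by linarith) t
  rw [← sub_eq_add_neg] at h
  -- Price `3/4` sells on `Q₁` only at a corner, so dropping this term loses nothing.
  have hlow := mul_nonneg (show 0 ≤ 1 / 3 - ε by linarith) M.lowRev_nonneg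
  rw [integral_rev_squareMixture (by linarith) (by linarith), hM, highRev_postedPrice le_rfl,
    ← hM]
  linarith

/-- If the histories for the mixture weights `1 / 3 ± ε` cannot be told apart, then the algorithm
has a large regret for one of the two weights. -/
theorem exists_regretAgainst_squareMixture_ge {ε δ r : ℝ} (h0 : 0 < ε) (h1 : ε ≤ 1 / 3) {T : ℕ}
    (hδ : ∀ t < T, ∀ g : (Fin t → Valuation) → ℝ, Measurable g → (∀ h, 0 ≤ g h) →
      (∀ h, g h ≤ 1) → ∫ h, g h ∂(Measure.pi fun _ : Fin t => squareMixture (1 / 3 + ε))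
        - ∫ h, g h ∂(Measure.pi fun _ : Fin t => squareMixture (1 / 3 - ε)) ≤ δ)
    (hr : 2 * r ≤ T * (3 / 2 * ε * (1 - δ))) :
    ∃ α ∈ Set.Icc (1 / 3 - ε) (1 / 3 + ε),
      (r : EReal) ≤ regretAgainst μ A T (Measure.pi fun _ => squareMixture α) := by
  have hplus := regretAgainst_squareMixture_add μ A h0.le (by linarith) T
  have hminus := regretAgainst_squareMixture_sub μ A h0.le h1 T
  set x := ∑ t : Fin T, 3 / 2 * ε * (1 - ∫ h, lowShare μ A t h
    ∂(Measure.pi fun _ : Fin t => squareMixture (1 / 3 + ε))) with hx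
  set y := ∑ t : Fin T, 3 / 2 * ε * ∫ h, lowShare μ A t h
    ∂(Measure.pi fun _ : Fin t => squareMixture (1 / 3 - ε)) with hy
  have hsum : 2 * r ≤ x + y := by
    have : ∑ _t : Fin T, 3 / 2 * ε * (1 - δ) ≤ x + y := by
      rw [hx, hy, ← Finset.sum_add_distrib]
      refine Finset.sum_le_sum fun t _ => ?_
      -- `lowShare` itself serves as the test function on histories.
      have := hδ t t.isLt _ (measurable_lowShare μ A t) (lowShare_nonneg μ A t)
        (lowShare_le_one μ A t)
      nlinarith
    rw [Finset.sum_const, Finset.card_univ, Fintype.card_fin, nsmul_eq_mul] at this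
    exact hr.trans this
  rcases le_total r x with h | h
  · exact ⟨1 / 3 + ε, ⟨by linarith, le_rfl⟩, (EReal.coe_le_coe_iff.2 h).trans hplus⟩
  · exact ⟨1 / 3 - ε, ⟨le_rfl, by linarith⟩,
      (EReal.coe_le_coe_iff.2 (by linarith : r ≤ y)).trans hminus⟩

theorem exists_regretAgainst_squareMixture_ge_sqrt (T : ℕ) :
    ∃ α ∈ Set.Ioo (4 / 15 : ℝ) (2 / 5), ((3 / 64 * Real.sqrt (T : ℝ) : ℝ) : EReal)
      ≤ regretAgainst μ A T (Measure.pi fun _ => squareMixture α) := by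
  have hsub : ∀ {ε α : ℝ}, ε < 1 / 15 → α ∈ Set.Icc (1 / 3 - ε) (1 / 3 + ε) →
      α ∈ Set.Ioo (4 / 15 : ℝ) (2 / 5) := fun hε hα =>
    ⟨by linarith [hα.1], by linarith [hα.2]⟩
  rcases Nat.lt_or_ge T 2 with hT | hT
  -- For `T = 1` the general choice `ε = 1/12` would leave the interval `(4/15, 2/5)`. With at most
  -- one round the history is empty, so `δ = 0` and the smaller `ε = 1/16` suffices.
  · obtain ⟨α, hα, h⟩ := exists_regretAgainst_squareMixture_ge μ A (ε := 1 / 16) (δ := 0)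
      (r := 3 / 64 * Real.sqrt T) (T := T) (by norm_num) (by norm_num) (fun t ht g _ _ _ => by
        obtain rfl : t = 0 := by omega
        simp only [Measure.pi_of_empty _ Fin.elim0, sub_self, le_refl]) (by interval_cases T <;> norm_num)
    exact ⟨α, hsub (by norm_num) hα, h⟩
  · have hs : 0 < Real.sqrt T := Real.sqrt_pos.2 (by positivity)
    have hT' : (2 : ℝ) ≤ T := by exact_mod_cast hT
    -- This makes `12 * √T > 15`, hence `ε < 1/15`, half the length of the interval for `α`.
    have hs' : 5 / 4 < Real.sqrt T := by
      rw [Real.lt_sqrt (by norm_num)]; linarith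
    have hε0 : 0 < 1 / (12 * Real.sqrt T) := by positivity
    have hε1 : 1 / (12 * Real.sqrt T) < 1 / 15 :=
      one_div_lt_one_div_of_lt (by norm_num) (by linarith)
    obtain ⟨α, hα, h⟩ := exists_regretAgainst_squareMixture_ge μ A (ε := 1 / (12 * Real.sqrt T))
      (δ := 1 / 4) (r := 3 / 64 * Real.sqrt T) (T := T) hε0 (by linarith) (fun t ht g hg h0 h1 => by
        refine integral_pi_squareMixture_sub_le hε0 (by linarith) ?_ hg h0 h1
        rw [Fintype.card_fin, div_pow, mul_pow, Real.sq_sqrt (Nat.cast_nonneg T)]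
        have : (t : ℝ) ≤ T := by exact_mod_cast ht.le
        field_simp
        linarith) (by
        have : (T : ℝ) * (3 / 2 * (1 / (12 * Real.sqrt T)) * (1 - 1 / 4))
            = 3 / 32 * (T / Real.sqrt T) := by field_simp; norm_num
        rw [this, Real.div_sqrt]
        linarith)
    exact ⟨α, hsub hε1 hα, h⟩

end Regret

end JointAds

theorem mainTheorem4 {Ω : Type*} [MeasurableSpace Ω] (μ : MeasureTheory.Measure Ω)
    [MeasureTheory.IsProbabilityMeasure μ] (A : JointAds.LearningAlgorithm Ω)
    (σ : ℝ) (hσ : 0 < σ) (hσ' : σ ≤ 1 / 12) (T : ℕ) :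
    ((3 / 64 * Real.sqrt (T : ℝ) : ℝ) : EReal) ≤ JointAds.smoothRegret σ μ A T ∧
    ∃ α ∈ Set.Ioo (4 / 15 : ℝ) (2 / 5),
      MeasureTheory.IsProbabilityMeasure (JointAds.squareMixture α) ∧
      JointAds.IsSmooth σ (JointAds.squareMixture α) ∧
      ((3 / 64 * Real.sqrt (T : ℝ) : ℝ) : EReal) ≤
        JointAds.regretAgainst μ A T
          (MeasureTheory.Measure.pi fun _ : Fin T => JointAds.squareMixture α) := by
  obtain ⟨α, hα, h⟩ := JointAds.exists_regretAgainst_squareMixture_ge_sqrt μ A T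
  have hp := JointAds.isProbabilityMeasure_squareMixture (α := α) (by linarith [hα.1])
    (by linarith [hα.2])
  have hs := JointAds.isSmooth_squareMixture (α := α) hσ hσ' (by linarith [hα.1])
    (by linarith [hα.2])
  exact ⟨le_iSup₂_of_le (fun _ => ⟨JointAds.squareMixture α, hp⟩) (fun _ => hs) h, α, hα, hp, hs, h⟩
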